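/- Let $\kappa$ and $\lambda$ be infinite cardinals, identified with initial von Neumann ordinals, and let $A \subseteq \lambda$. Write ${}^{\kappa}\lambda$ for the set of all functions from $\kappa$ to $\lambda$. For functions $f, g : {}^{\kappa}\lambda \to \kappa$, say that $g$ (everywhere) dominates $f$ if $f(x) \le g(x)$ for all $x \in {}^{\kappa}\lambda$. Then there is a function $f : {}^{\kappa}\lambda \to \kappa$ such that for every transitive model $M$ of ZF (a transitive set or proper class $M$ such that $\langle M, \in \rangle$ satisfies every axiom of ZF) with ${}^{\kappa}\lambda \subseteq M$, if some function $g : {}^{\kappa}\lambda \to \kappa$ with $g \in M$ dominates $f$, then $A \in M$. Moreover, $f$ can be taken to be the following function: $f(x) = \alpha + 1$ if $\alpha < \kappa$ is least with $x(\alpha) \in A$, and $f(x) = 0$ if there is no $\alpha < \kappa$ with $x(\alpha) \in A$. -/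

import Mathlib

universe u

namespace ZFModel

open FirstOrder FirstOrder.Language

/-- The relation symbols of the language of set theory: one binary symbol. -/
inductive MemRel : ℕ → Type
  | mem : MemRel 2

/-- The first-order language of set theory. -/
def LSet : FirstOrder.Language := ⟨fun _ => Empty, MemRel⟩

/-- A class `M` of sets, seen as the structure `⟨M, ∈⟩`. -/
instance structureOfClass (M : Set ZFSet.{u}) : LSet.Structure M where
  funMap := fun f => Empty.elim f
  RelMap := fun R => match R with
    | .mem => fun v => (v 0 : ZFSet.{u}) ∈ (v 1 : ZFSet.{u})

/-- The atomic formula `s ∈ t`. -/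
def mem {α : Type} {n : ℕ} (s t : LSet.Term (α ⊕ Fin n)) : LSet.BoundedFormula α n :=
  Relations.boundedFormula₂ (L := LSet) MemRel.mem s t

/-- `∀ x y, (∀ z, z ∈ x ↔ z ∈ y) → x = y`. -/
def extensionality : LSet.Sentence :=
  ∀' ∀' ((∀' (mem (&2) (&0) ⇔ mem (&2) (&1))) ⟹ (&0 =' &1))

/-- `∀ x, (∃ y, y ∈ x) → ∃ y, y ∈ x ∧ ¬ ∃ z, z ∈ x ∧ z ∈ y`. -/
def foundation : LSet.Sentence :=
  ∀' ((∃' mem (&1) (&0)) ⟹ ∃' (mem (&1) (&0) ⊓ ∼(∃' (mem (&2) (&0) ⊓ mem (&2) (&1)))))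

/-- `∀ x y, ∃ p, ∀ z, z ∈ p ↔ z = x ∨ z = y`. -/
def pairing : LSet.Sentence :=
  ∀' ∀' ∃' ∀' (mem (&3) (&2) ⇔ ((&3 =' &0) ⊔ (&3 =' &1)))

/-- `∀ x, ∃ u, ∀ z, z ∈ u ↔ ∃ y, y ∈ x ∧ z ∈ y`. -/
def union : LSet.Sentence :=
  ∀' ∃' ∀' (mem (&2) (&1) ⇔ ∃' (mem (&3) (&0) ⊓ mem (&2) (&3)))

/-- `∀ x, ∃ p, ∀ y, y ∈ p ↔ ∀ z, z ∈ y → z ∈ x`. -/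
def powerSet : LSet.Sentence :=
  ∀' ∃' ∀' (mem (&2) (&1) ⇔ ∀' (mem (&3) (&2) ⟹ mem (&3) (&0)))

/-- `∃ x, (∃ e, e ∈ x ∧ ∀ z, z ∉ e) ∧
  ∀ y, y ∈ x → ∃ s, s ∈ x ∧ ∀ z, z ∈ s ↔ z ∈ y ∨ z = y`. -/
def infinity : LSet.Sentence :=
  ∃' ((∃' (mem (&1) (&0) ⊓ ∀' ∼(mem (&2) (&1)))) ⊓
    ∀' (mem (&1) (&0) ⟹
      ∃' (mem (&2) (&0) ⊓ ∀' (mem (&3) (&2) ⇔ (mem (&3) (&1) ⊔ (&3 =' &1))))))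

/-- The universal closure of a formula in the free variables `p₀, …, pₙ₋₁`. -/
noncomputable def closure {n : ℕ} (ψ : LSet.Formula (Fin n)) : LSet.Sentence :=
  Formula.iAlls (Fin n) (Formula.relabel (Sum.inr : Fin n → Empty ⊕ Fin n) ψ)

/-- For a formula `φ(p, x)` with parameters `p = (p₀, …, pₙ₋₁)`:
`∀ p, ∀ a, ∃ b, ∀ x, x ∈ b ↔ x ∈ a ∧ φ(p, x)`. -/
noncomputable def separation (n : ℕ) (φ : LSet.Formula (Fin n ⊕ Fin 1)) : LSet.Sentence :=
  closure (∀' ∃' ∀' (mem (&2) (&1) ⇔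
    (mem (&2) (&0) ⊓ BoundedFormula.relabel (n := 3) (Sum.map id ![2]) φ)))

/-- For a formula `φ(p, x, y)` with parameters `p = (p₀, …, pₙ₋₁)`:
`∀ p, (∀ x y z, φ(p, x, y) ∧ φ(p, x, z) → y = z) →
  ∀ a, ∃ b, ∀ y, y ∈ b ↔ ∃ x, x ∈ a ∧ φ(p, x, y)`. -/
noncomputable def replacement (n : ℕ) (φ : LSet.Formula (Fin n ⊕ Fin 2)) : LSet.Sentence :=
  closure
    ((∀' ∀' ∀' ((BoundedFormula.relabel (n := 3) (Sum.map id ![0, 1]) φ ⊓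
        BoundedFormula.relabel (n := 3) (Sum.map id ![0, 2]) φ) ⟹ (&1 =' &2))) ⟹
      ∀' ∃' ∀' (mem (&2) (&1) ⇔
        ∃' (mem (&3) (&0) ⊓ BoundedFormula.relabel (n := 4) (Sum.map id ![3, 2]) φ)))

/-- Zermelo–Fraenkel set theory (without the axiom of choice). -/
def ZF : LSet.Theory :=
  {extensionality, foundation, pairing, union, powerSet, infinity} ∪
    {σ | ∃ n φ, σ = separation n φ} ∪ {σ | ∃ n φ, σ = replacement n φ}

/-- `M` (a set or a proper class) is a transitive model of ZF. -/
def IsTransitiveModel (M : Set ZFSet.{u}) : Prop :=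
  (∀ x ∈ M, ∀ y ∈ x, y ∈ M) ∧ M ⊨ ZF

/-- The initial (von Neumann) ordinal of a cardinal. -/
noncomputable def vN (κ : Cardinal.{u}) : ZFSet.{u} := κ.ord.toZFSet

/-- For ordinal-valued functions `f`, `g` with domain `X`:
`f(x) ≤ g(x)` for every `x ∈ X`. (The order of ordinals is inclusion.) -/
def Dominates (X g f : ZFSet.{u}) : Prop :=
  ∀ x ∈ X, ∀ a b : ZFSet.{u}, ZFSet.pair x a ∈ f → ZFSet.pair x b ∈ g → a ⊆ b

end ZFModel

/-!
Write `K` and `L` for the ordinals `κ` and `λ`, and let `g ∈ M` dominate the first-entrance function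
`f` of `A`.

There are a stage `α ∈ K` and values `G β ∈ L \ A` for `β ∈ α` such that every `a ∈ L \ A` admits
some `y : K → L` which extends `G ↾ α`, has `y(α) = a`, and satisfies `g(y) ≤ α` (`exists_stage`).
Otherwise one could choose by recursion, at every stage `α`, a value `F α ∈ L \ A` such that
`α < g(y)` for all `y` extending `F ↾ (α + 1)`. The function `F ↾ K` itself would be such a `y` for
all `α ∈ K`, so that `g(F ↾ K)` would exceed all elements of `K`, itself included.

On the other hand, if `a ∈ A`, then every `y` that extends `G ↾ α` and has `y(α) = a` enters `A` for
the first time at `α`, whence `α < α + 1 = f(y) ≤ g(y)`. So `A` is the set of those `a ∈ L` for which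
all `y` extending `G ↾ α` with `y(α) = a` satisfy `α < g(y)`. This is a definition in `M`, with the
parameters `g`, `α` and any `x : K → L` that extends `G ↾ α`; it only speaks of elements of the
transitive closures of the parameters, and is therefore absolute for the transitive class `M`
(`IsTransitiveModel.forced_mem`). The bounding set for Separation is obtained from `g` by five
applications of Union, which reach the values of the functions in the domain of `g`.
-/

namespace ZFModel

open FirstOrder FirstOrder.Language

variable {M : Set ZFSet.{u}}

/-! ### Axioms of ZF in a transitive model -/

theorem realize_mem {α : Type} {n : ℕ} (s t : LSet.Term (α ⊕ Fin n)) (v : α → M)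
    (xs : Fin n → M) :
    (mem s t).Realize v xs ↔ ((s.realize (Sum.elim v xs) : M) : ZFSet.{u}) ∈
      ((t.realize (Sum.elim v xs) : M) : ZFSet.{u}) :=
  BoundedFormula.realize_rel₂ (L := LSet) (R := (MemRel.mem : LSet.Relations 2))

theorem IsTransitiveModel.pair_mem (hM : IsTransitiveModel M) {a b : ZFSet.{u}}
    (ha : a ∈ M) (hb : b ∈ M) : ({a, b} : ZFSet.{u}) ∈ M := by
  have h : M ⊨ pairing := hM.2.realize_of_mem _ (by simp [ZF])
  simp [pairing, Sentence.Realize, Formula.Realize, realize_mem, Fin.snoc] at h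
  obtain ⟨c, hc, h⟩ := h a ha b hb
  convert hc
  ext z
  rw [ZFSet.mem_pair]
  constructor
  · rintro (rfl | rfl)
    · exact (h _ ha).2 (.inl rfl)
    · exact (h _ hb).2 (.inr rfl)
  · exact fun hz => (h z (hM.1 c hc z hz)).1 hz

theorem IsTransitiveModel.sUnion_mem (hM : IsTransitiveModel M) {a : ZFSet.{u}}
    (ha : a ∈ M) : (ZFSet.sUnion a : ZFSet.{u}) ∈ M := by
  have h : M ⊨ union := hM.2.realize_of_mem _ (by simp [ZF])
  simp [union, Sentence.Realize, Formula.Realize, realize_mem, Fin.snoc] at h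
  obtain ⟨c, hc, h⟩ := h a ha
  convert hc
  ext z
  rw [ZFSet.mem_sUnion]
  constructor
  · rintro ⟨y, hy, hz⟩
    have hyM := hM.1 a ha y hy
    exact (h z (hM.1 y hyM z hz)).2 ⟨y, hy, hyM, hz⟩
  · intro hz
    obtain ⟨y, hy, -, hzy⟩ := (h z (hM.1 c hc z hz)).1 hz
    exact ⟨y, hy, hzy⟩

/-- Separation for a predicate `P` on sets that agrees on `M` with the interpretation of a formula
in `M`. -/
theorem IsTransitiveModel.sep_mem (hM : IsTransitiveModel M) {n : ℕ}
    (φ : LSet.Formula (Fin n ⊕ Fin 1)) (p : Fin n → M) {a : ZFSet.{u}} (ha : a ∈ M)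
    (P : ZFSet.{u} → Prop)
    (hP : ∀ x : M, φ.Realize (Sum.elim p ![x]) ↔ P x) : ZFSet.sep P a ∈ M := by
  have h : M ⊨ separation n φ := hM.2.realize_of_mem _ (.inl (.inr ⟨n, φ, rfl⟩))
  rw [separation, closure, Sentence.Realize, Formula.realize_iAlls] at h
  have h := h p
  rw [Formula.realize_relabel] at h
  simp only [Formula.Realize, BoundedFormula.realize_all, BoundedFormula.realize_ex,
    BoundedFormula.realize_iff, BoundedFormula.realize_inf, BoundedFormula.realize_relabel,
    realize_mem] at h
  obtain ⟨⟨b, hb⟩, h⟩ := h ⟨a, ha⟩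
  have h : ∀ x : M, (x : ZFSet.{u}) ∈ b ↔ (x : ZFSet.{u}) ∈ a ∧ P x := by
    intro x
    refine (h x).trans (and_congr Iff.rfl ?_)
    rw [← hP]
    refine iff_of_eq (congrArg₂ _ (funext ?_) (Subsingleton.elim _ _))
    rintro (i | i)
    · rfl
    · rw [Subsingleton.elim i 0]; rfl
  convert hb
  ext z
  rw [ZFSet.mem_sep]
  exact ⟨fun hz => (h ⟨z, hM.1 a ha z hz.1⟩).2 hz, fun hz => (h ⟨z, hM.1 b hb z hz⟩).1 hz⟩

/-! ### Ordered pairs in the language of set theory -/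

/-- The variable `i`, seen one quantifier deeper. -/
def lift {α : Type} {n : ℕ} (i : α ⊕ Fin n) : α ⊕ Fin (n + 1) := Sum.map id Fin.castSucc i

/-- The formula `p = (a, b)` for Kuratowski pairs, that is `∀ z, z ∈ p ↔ z = {a} ∨ z = {a, b}`. -/
def isPair {α : Type} {n : ℕ} (p a b : α ⊕ Fin n) : LSet.BoundedFormula α n :=
  let z : LSet.Term (α ⊕ Fin (n + 1)) := Term.var (Sum.inr (Fin.last n))
  let z' : LSet.Term (α ⊕ Fin (n + 2)) := Term.var (lift (Sum.inr (Fin.last n)))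
  let w : LSet.Term (α ⊕ Fin (n + 2)) := Term.var (Sum.inr (Fin.last (n + 1)))
  let a' : LSet.Term (α ⊕ Fin (n + 2)) := Term.var (lift (lift a))
  let b' : LSet.Term (α ⊕ Fin (n + 2)) := Term.var (lift (lift b))
  ∀' (mem z (Term.var (lift p)) ⇔
    ((∀' (mem w z' ⇔ (w =' a'))) ⊔ (∀' (mem w z' ⇔ ((w =' a') ⊔ (w =' b'))))))

theorem elim_snoc_lift {α : Type} {n : ℕ} (v : α → M) (xs : Fin n → M) (y : M)
    (i : α ⊕ Fin n) : Sum.elim v (Fin.snoc xs y : Fin (n + 1) → M) (lift i) = Sum.elim v xs i := by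
  rcases i with i | i
  · rfl
  · exact Fin.snoc_castSucc (α := fun _ => M) y xs i

theorem elim_snoc_last {α : Type} {n : ℕ} (v : α → M) (xs : Fin n → M) (y : M) :
    Sum.elim v (Fin.snoc xs y : Fin (n + 1) → M) (Sum.inr (Fin.last n)) = y :=
  Fin.snoc_last (α := fun _ => M) y xs

theorem IsTransitiveModel.realize_isPair (hM : IsTransitiveModel M) {α : Type} {n : ℕ}
    (p a b : α ⊕ Fin n) (v : α → M) (xs : Fin n → M) :
    (isPair p a b).Realize v xs ↔
      ((Sum.elim v xs p : M) : ZFSet.{u}) =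
        ZFSet.pair (Sum.elim v xs a : M) (Sum.elim v xs b : M) := by
  simp only [isPair, BoundedFormula.realize_all, BoundedFormula.realize_iff, realize_mem,
    BoundedFormula.realize_sup, BoundedFormula.realize_bdEqual, Term.realize_var, elim_snoc_lift,
    elim_snoc_last]
  generalize Sum.elim v xs p = p
  generalize Sum.elim v xs a = a
  generalize Sum.elim v xs b = b
  have hs : ∀ z : M, (∀ w : M, (w : ZFSet.{u}) ∈ (z : ZFSet.{u}) ↔ w = a) ↔
      (z : ZFSet.{u}) = {(a : ZFSet.{u})} := by
    intro z
    rw [ZFSet.ext_iff]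
    simp only [ZFSet.mem_singleton]
    refine ⟨fun h w => ⟨fun hw => ?_, ?_⟩, fun h w => (h w).trans Subtype.ext_iff.symm⟩
    · exact congrArg Subtype.val ((h ⟨w, hM.1 z z.2 w hw⟩).1 hw)
    · rintro rfl
      exact (h a).2 rfl
  have hp : ∀ z : M, (∀ w : M, (w : ZFSet.{u}) ∈ (z : ZFSet.{u}) ↔ w = a ∨ w = b) ↔
      (z : ZFSet.{u}) = {(a : ZFSet.{u}), (b : ZFSet.{u})} := by
    intro z
    rw [ZFSet.ext_iff]
    simp only [ZFSet.mem_pair]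
    refine ⟨fun h w => ⟨fun hw => ?_, ?_⟩, fun h w => (h w).trans
      (or_congr Subtype.ext_iff.symm Subtype.ext_iff.symm)⟩
    · exact ((h ⟨w, hM.1 z z.2 w hw⟩).1 hw).imp (congrArg Subtype.val) (congrArg Subtype.val)
    · rintro (rfl | rfl)
      · exact (h a).2 (.inl rfl)
      · exact (h b).2 (.inr rfl)
  simp only [hs, hp]
  -- Both elements of the Kuratowski pair lie in `M`, so the quantifier over `M` sees all of it.
  have haa : ({(a : ZFSet.{u})} : ZFSet.{u}) ∈ M := by
    simpa [ZFSet.pair_eq_singleton] using hM.pair_mem a.2 a.2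
  have hab := hM.pair_mem a.2 b.2
  rw [ZFSet.ext_iff]
  simp only [ZFSet.pair, ZFSet.mem_pair]
  refine ⟨fun h z => ⟨fun hz => (h ⟨z, hM.1 p p.2 z hz⟩).1 hz, ?_⟩, fun h z => h z⟩
  rintro (rfl | rfl)
  · exact (h ⟨_, haa⟩).2 (.inl rfl)
  · exact (h ⟨_, hab⟩).2 (.inr rfl)

/-! ### The definition of `A` inside the model -/

/-- The parameter `pᵢ` of a separation formula with three parameters, inside `n` quantifiers. -/
abbrev par {n : ℕ} (i : Fin 3) : (Fin 3 ⊕ Fin 1) ⊕ Fin n := Sum.inl (Sum.inl i)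

/-- The element variable of a separation formula with three parameters, inside `n` quantifiers. -/
abbrev elt {n : ℕ} : (Fin 3 ⊕ Fin 1) ⊕ Fin n := Sum.inl (Sum.inr 0)

/-- With the parameters `g`, `x`, `α` and the element `a`, the formula saying that `y(α) = a` for some
`y` in the domain of `g`:
`∃ y γ p q, p ∈ g ∧ p = (y, γ) ∧ q ∈ y ∧ q = (α, a)`. -/
def occursFormula : LSet.Formula (Fin 3 ⊕ Fin 1) :=
  ∃' ∃' ∃' ∃' (mem (&2) (Term.var (par 0)) ⊓ isPair (Sum.inr 2) (Sum.inr 0) (Sum.inr 1) ⊓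
    mem (&3) (&0) ⊓ isPair (Sum.inr 3) (par 2) elt)

/-- With the parameters `g`, `x`, `α` and the element `a`, the formula saying that `α ∈ g(y)` for
every `y` in the domain of `g` that agrees with `x` below `α` and has `y(α) = a`:
`∀ y γ p q, p ∈ g → p = (y, γ) → q ∈ y → q = (α, a) →
  (∀ r β z, r ∈ x → β ∈ α → r = (β, z) → r ∈ y) → α ∈ γ`. -/
def forcedFormula : LSet.Formula (Fin 3 ⊕ Fin 1) :=
  ∀' ∀' ∀' ∀' (mem (&2) (Term.var (par 0)) ⟹ isPair (Sum.inr 2) (Sum.inr 0) (Sum.inr 1) ⟹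
    mem (&3) (&0) ⟹ isPair (Sum.inr 3) (par 2) elt ⟹
    (∀' ∀' ∀' (mem (&4) (Term.var (par 1)) ⟹ mem (&5) (Term.var (par 2)) ⟹
      isPair (Sum.inr 4) (Sum.inr 5) (Sum.inr 6) ⟹ mem (&4) (&0))) ⟹
    mem (Term.var (par 2)) (&1))

theorem IsTransitiveModel.of_pair_mem (hM : IsTransitiveModel M) {a b c : ZFSet.{u}} (hc : c ∈ M)
    (h : ZFSet.pair a b ∈ c) : ZFSet.pair a b ∈ M ∧ a ∈ M ∧ b ∈ M := by
  have hp := hM.1 c hc _ h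
  have hab := hM.1 _ hp {a, b} (by simp [ZFSet.pair])
  exact ⟨hp, hM.1 _ hab a (by simp), hM.1 _ hab b (by simp)⟩

theorem realize_occursFormula (hM : IsTransitiveModel M) (g x α a : M) :
    occursFormula.Realize (Sum.elim ![g, x, α] ![a]) ↔
      ∃ y γ : ZFSet.{u}, ZFSet.pair y γ ∈ (g : ZFSet.{u}) ∧ ZFSet.pair (α : ZFSet.{u}) a ∈ y := by
  simp [occursFormula, Formula.Realize, hM.realize_isPair, realize_mem, Fin.snoc]
  constructor
  · rintro ⟨⟨y, ⟨γ, hγ, -⟩, -, hy⟩, -⟩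
    exact ⟨y, ⟨γ, hγ⟩, hy⟩
  · rintro ⟨y, ⟨γ, hγ⟩, hy⟩
    obtain ⟨hpM, hyM, hγM⟩ := hM.of_pair_mem g.2 hγ
    exact ⟨⟨y, ⟨γ, hγ, hγM, hpM⟩, hyM, hy⟩, (hM.of_pair_mem hyM hy).1⟩

theorem realize_forcedFormula (hM : IsTransitiveModel M) (g x α a : M) :
    forcedFormula.Realize (Sum.elim ![g, x, α] ![a]) ↔
      ∀ y γ : ZFSet.{u}, ZFSet.pair y γ ∈ (g : ZFSet.{u}) → ZFSet.pair (α : ZFSet.{u}) a ∈ y →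
        (∀ β ∈ (α : ZFSet.{u}), ∀ z, ZFSet.pair β z ∈ (x : ZFSet.{u}) → ZFSet.pair β z ∈ y) →
        (α : ZFSet.{u}) ∈ γ := by
  simp [forcedFormula, Formula.Realize, hM.realize_isPair, realize_mem, Fin.snoc]
  constructor
  · intro h y γ hγ hy hx
    obtain ⟨hpM, hyM, hγM⟩ := hM.of_pair_mem g.2 hγ
    refine h y hyM γ hγM _ hpM _ (hM.of_pair_mem hyM hy).1 hγ rfl hy rfl ?_
    rintro _ - β - z - hp hβ rfl
    exact hx β hβ z hp
  · rintro h y - γ - _ - _ - hγ rfl hy rfl hx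
    refine h y γ hγ hy fun β hβ z hp => ?_
    obtain ⟨hpM, hβM, hzM⟩ := hM.of_pair_mem x.2 hp
    exact hx _ hpM β hβM z hzM hp hβ rfl

/-- A set lies in `M` if it consists of the values `a` at `α`, of functions in the domain of `g`, such
that `α ∈ g(y)` for every such function `y` that agrees with `x` below `α` and has `y(α) = a`.
No bound for the set is assumed. -/
theorem IsTransitiveModel.forced_mem (hM : IsTransitiveModel M) {g x α : ZFSet.{u}} (hg : g ∈ M)
    (hx : x ∈ M) (hα : α ∈ M) {A : ZFSet.{u}}
    (hA : ∀ a, a ∈ A ↔ (∃ y γ, ZFSet.pair y γ ∈ g ∧ ZFSet.pair α a ∈ y) ∧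
      ∀ y γ, ZFSet.pair y γ ∈ g → ZFSet.pair α a ∈ y →
        (∀ β ∈ α, ∀ z, ZFSet.pair β z ∈ x → ZFSet.pair β z ∈ y) → α ∈ γ) : A ∈ M := by
  have hsU : ∀ {a b c : ZFSet.{u}}, ZFSet.pair a b ∈ c →
      a ∈ c.sUnion.sUnion ∧ b ∈ c.sUnion.sUnion := fun {a b c} h =>
    have hab : ({a, b} : ZFSet.{u}) ∈ c.sUnion :=
      ZFSet.mem_sUnion.2 ⟨_, h, by simp [ZFSet.pair]⟩
    ⟨ZFSet.mem_sUnion.2 ⟨_, hab, by simp⟩, ZFSet.mem_sUnion.2 ⟨_, hab, by simp⟩⟩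
  -- Two unions lead from `g` to the functions `y`, one from there to the pairs `(α, a)`
  -- (elements of `y`), and two more to `a`.
  have hU := hM.sUnion_mem (hM.sUnion_mem (hM.sUnion_mem (hM.sUnion_mem (hM.sUnion_mem hg))))
  have h := hM.sep_mem (occursFormula ⊓ forcedFormula) ![⟨g, hg⟩, ⟨x, hx⟩, ⟨α, hα⟩] hU (· ∈ A)
    fun a => by
      rw [Formula.realize_inf, realize_occursFormula hM, realize_forcedFormula hM, hA]
  convert h
  ext a
  rw [ZFSet.mem_sep]
  refine ⟨fun ha => ⟨?_, ha⟩, fun ha => ha.2⟩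
  obtain ⟨⟨y, γ, hy, ha⟩, -⟩ := (hA a).1 ha
  exact (hsU (ZFSet.mem_sUnion.2 ⟨y, (hsU hy).1, ha⟩)).2

/-! ### Dominating the first-entrance function -/

open Classical in
/-- For any `g`, there is a sequence `G ↾ α` of elements of `L \ A` such that
each one-step extension of it by an element of `L \ A` has a further extension `y : K → L` with
`α ∉ g(y)`. It is obtained by diagonalization, without reference to the first-entrance function. -/
theorem exists_stage {K L A g : ZFSet.{u}} (hK : K.IsTransitive)
    (hg : g ∈ ZFSet.funs (ZFSet.funs K L) K) :
    ∃ α ∈ K, ∃ G : ZFSet.{u} → ZFSet.{u}, (∀ β ∈ α, G β ∈ L \ A) ∧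
      ∀ a ∈ L \ A, ∃ y γ, ZFSet.pair y γ ∈ g ∧ ZFSet.pair α a ∈ y ∧
        (∀ β ∈ α, ZFSet.pair β (G β) ∈ y) ∧ α ∉ γ := by
  let _ := @Classical.allZFSetDefinable
  by_contra! hcon
  -- `Q α G a`: extending `G ↾ α` by `a ∈ L \ A` at `α` forces `α ∈ g(y)`.
  let Q (α : ZFSet.{u}) (G : ZFSet.{u} → ZFSet.{u}) (a : ZFSet.{u}) : Prop :=
    a ∈ L \ A ∧ ∀ y γ, ZFSet.pair y γ ∈ g → ZFSet.pair α a ∈ y →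
        (∀ β ∈ α, ZFSet.pair β (G β) ∈ y) → α ∈ γ
  let step (α : ZFSet.{u}) (ih : ∀ β, β ∈ α → ZFSet.{u}) : ZFSet.{u} :=
    epsilon (Q α fun β => if hβ : β ∈ α then ih β hβ else ∅)
  let F : ZFSet.{u} → ZFSet.{u} := ZFSet.mem_wf.fix step
  have hF : ∀ α, F α = epsilon (Q α F) := by
    intro α
    refine (ZFSet.mem_wf.fix_eq step α).trans (congrArg epsilon (funext fun a => ?_))
    have : ∀ y : ZFSet.{u}, (∀ β ∈ α, ZFSet.pair β (if β ∈ α then F β else ∅) ∈ y) ↔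
        ∀ β ∈ α, ZFSet.pair β (F β) ∈ y :=
      fun y => forall₂_congr fun β hβ => by rw [if_pos hβ]
    simp only [Q, dite_eq_ite]
    exact propext (and_congr Iff.rfl (forall₂_congr fun y γ => by rw [← this y]))
  have hQ : ∀ α ∈ K, Q α F (F α) := by
    intro α
    induction α using ZFSet.inductionOn with
    | _ α ih =>
      intro hα
      obtain ⟨a, ha, h⟩ := hcon α hα F fun β hβ => (ih β hβ (hK α hα hβ)).1
      rw [hF α]
      exact epsilon_spec (p := Q α F) ⟨a, ha, h⟩
  have hx : ZFSet.map F K ∈ ZFSet.funs K L := ZFSet.mem_funs.2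
    (ZFSet.map_isFunc.2 fun α hα => (ZFSet.mem_sdiff.1 (hQ α hα).1).1)
  -- The stage `γ = g(F ↾ K)` forces `γ ∈ γ`.
  obtain ⟨γ, hγ, -⟩ := (ZFSet.mem_funs.1 hg).2 _ hx
  have hγK : γ ∈ K := (ZFSet.pair_mem_prod.1 ((ZFSet.mem_funs.1 hg).1 hγ)).2
  have hF' : ∀ β ∈ K, ZFSet.pair β (F β) ∈ ZFSet.map F K := fun β hβ =>
    ZFSet.mem_map.2 ⟨β, hβ, rfl⟩
  exact ZFSet.mem_irrefl γ
    ((hQ γ hγK).2 _ γ hγ (hF' γ hγK) fun β hβ => hF' β (hK γ hγK hβ))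

open Classical in
/-- The main claim for a transitive set `K`. Of the dominated `f`, only the values at functions that
enter `A` matter. -/
theorem mem_of_dominates {K L A f g : ZFSet.{u}} (hK : K.IsTransitive) (hL : ∅ ∈ L)
    (hA : A ⊆ L) (hf : ∀ x ∈ ZFSet.funs K L, ∀ α ∈ K, (∃ a ∈ A, ZFSet.pair α a ∈ x) →
      (∀ β ∈ α, ∀ a ∈ A, ZFSet.pair β a ∉ x) → ZFSet.pair x (insert α α) ∈ f)
    (hM : IsTransitiveModel M) (hx : ∀ x ∈ ZFSet.funs K L, x ∈ M)
    (hg : g ∈ ZFSet.funs (ZFSet.funs K L) K) (hgM : g ∈ M)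
    (hfg : Dominates (ZFSet.funs K L) g f) : A ∈ M := by
  let _ := @Classical.allZFSetDefinable
  have hg' := ZFSet.mem_funs.1 hg
  have huniq : ∀ {y : ZFSet.{u}}, y ∈ ZFSet.funs K L → ∀ {α b c : ZFSet.{u}},
      ZFSet.pair α b ∈ y → ZFSet.pair α c ∈ y → b = c := by
    intro y hy α b c hb hc
    have hy := ZFSet.mem_funs.1 hy
    exact (hy.2 α (ZFSet.pair_mem_prod.1 (hy.1 hb)).1).unique hb hc
  obtain ⟨α, hα, G, hG, hα'⟩ := exists_stage (A := A) hK hg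
  -- `M` is only known to contain the total functions, so `G ↾ α` is coded by an extension to `K`.
  let x := ZFSet.map (fun β => if β ∈ α then G β else ∅) K
  have hxL : x ∈ ZFSet.funs K L := ZFSet.mem_funs.2 (ZFSet.map_isFunc.2 fun β _ => by
    split_ifs with h
    · exact (ZFSet.mem_sdiff.1 (hG β h)).1
    · exact hL)
  have hxG : ∀ β ∈ α, ∀ z, ZFSet.pair β z ∈ x ↔ z = G β := by
    intro β hβ z
    have h : ZFSet.pair β (G β) ∈ x :=
      ZFSet.mem_map.2 ⟨β, hK α hα hβ, by simp [hβ]⟩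
    exact ⟨fun hz => huniq hxL hz h, fun hz => hz ▸ h⟩
  have hαM : α ∈ M :=
    have h : ZFSet.pair α ∅ ∈ x := ZFSet.mem_map.2 ⟨α, hα, by simp [ZFSet.mem_irrefl]⟩
    (hM.of_pair_mem (hx x hxL) h).2.1
  refine hM.forced_mem hgM (hx x hxL) hαM fun a => ⟨fun ha => ⟨?_, ?_⟩, ?_⟩
  · have hy : ZFSet.map (fun _ => a) K ∈ ZFSet.funs K L :=
      ZFSet.mem_funs.2 (ZFSet.map_isFunc.2 fun _ _ => hA ha)
    obtain ⟨γ, hγ, -⟩ := hg'.2 _ hy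
    exact ⟨_, γ, hγ, ZFSet.mem_map.2 ⟨α, hα, rfl⟩⟩
  · intro y γ hγ hy hxy
    have hyL := (ZFSet.pair_mem_prod.1 (hg'.1 hγ)).1
    refine hfg y hyL _ γ (hf y hyL α hα ⟨a, ha, hy⟩ fun β hβ b hb hβb => ?_) hγ
      (ZFSet.mem_insert α α)
    have := huniq hyL hβb (hxy β hβ _ ((hxG β hβ _).2 rfl))
    exact (ZFSet.mem_sdiff.1 (hG β hβ)).2 (this ▸ hb)
  · rintro ⟨⟨y, γ, hγ, hy⟩, h⟩
    have hyL := (ZFSet.pair_mem_prod.1 (hg'.1 hγ)).1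
    have haL : a ∈ L := (ZFSet.pair_mem_prod.1 ((ZFSet.mem_funs.1 hyL).1 hy)).2
    by_contra haA
    obtain ⟨y, γ, hγ, hy, hxy, hn⟩ := hα' a (ZFSet.mem_sdiff.2 ⟨haL, haA⟩)
    exact hn (h y γ hγ hy fun β hβ z hz => (hxG β hβ z).1 hz ▸ hxy β hβ)

open Classical in
/-- The first-entrance function of `A` exists: it maps `x : K → L` to `α + 1` if `α` is least with
`x(α) ∈ A`, and to `0` if there is no such `α`. -/
theorem exists_firstEntrance {K L A : ZFSet.{u}} (hK : K.IsOrdinal) (h0 : ∅ ∈ K)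
    (hs : ∀ α ∈ K, insert α α ∈ K) :
    ∃ f ∈ ZFSet.funs (ZFSet.funs K L) K, ∀ x ∈ ZFSet.funs K L,
      ((∀ α ∈ K, ∀ a ∈ A, ZFSet.pair α a ∉ x) → ZFSet.pair x ∅ ∈ f) ∧
      ∀ α ∈ K, (∃ a ∈ A, ZFSet.pair α a ∈ x) →
        (∀ β ∈ α, ∀ a ∈ A, ZFSet.pair β a ∉ x) → ZFSet.pair x (insert α α) ∈ f := by
  let _ := @Classical.allZFSetDefinable
  let P (x α : ZFSet.{u}) : Prop := α ∈ K ∧ (∃ a ∈ A, ZFSet.pair α a ∈ x) ∧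
    ∀ β ∈ α, ∀ a ∈ A, ZFSet.pair β a ∉ x
  have hP : ∀ {x α β}, P x α → P x β → α = β := by
    intro x α β hα hβ
    rcases (hK.mem hα.1).mem_trichotomous (hK.mem hβ.1) with h | h | h
    · obtain ⟨a, ha, hax⟩ := hα.2.1
      exact (hβ.2.2 α h a ha hax).elim
    · exact h
    · obtain ⟨a, ha, hax⟩ := hβ.2.1
      exact (hα.2.2 β h a ha hax).elim
  let F (x : ZFSet.{u}) : ZFSet.{u} := if h : ∃ α, P x α then insert h.choose h.choose else ∅
  refine ⟨ZFSet.map F (ZFSet.funs K L), ZFSet.mem_funs.2 (ZFSet.map_isFunc.2 fun x _ => ?_),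
    fun x hx => ⟨fun h => ZFSet.mem_map.2 ⟨x, hx, ?_⟩,
      fun α hα hα₁ hα₂ => ZFSet.mem_map.2 ⟨x, hx, ?_⟩⟩⟩
  · simp only [F]
    split_ifs with h
    · exact hs _ h.choose_spec.1
    · exact h0
  · have : ¬ ∃ α, P x α := fun ⟨α, hα, ⟨a, ha, hax⟩, _⟩ => h α hα a ha hax
    simp only [F, dif_neg this]
  · have h : ∃ α, P x α := ⟨α, hα, hα₁, hα₂⟩
    have := hP h.choose_spec ⟨hα, hα₁, hα₂⟩
    simp only [F, dif_pos h, this]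

end ZFModel

theorem mainTheorem1 (κ lam : Cardinal.{u}) (hκ : Cardinal.aleph0 ≤ κ)
    (hlam : Cardinal.aleph0 ≤ lam) (A : ZFSet.{u}) (hA : A ⊆ ZFModel.vN lam) :
    ∃ f ∈ ZFSet.funs (ZFSet.funs (ZFModel.vN κ) (ZFModel.vN lam)) (ZFModel.vN κ),
      -- `f(x) = α + 1` for the least `α < κ` with `x(α) ∈ A`, and `f(x) = 0` if there is none
      (∀ x ∈ ZFSet.funs (ZFModel.vN κ) (ZFModel.vN lam),
        ((∀ α ∈ ZFModel.vN κ, ∀ a ∈ A, ZFSet.pair α a ∉ x) → ZFSet.pair x ∅ ∈ f) ∧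
        ∀ α ∈ ZFModel.vN κ, (∃ a ∈ A, ZFSet.pair α a ∈ x) →
          (∀ β ∈ α, ∀ a ∈ A, ZFSet.pair β a ∉ x) → ZFSet.pair x (insert α α) ∈ f) ∧
      ∀ M : Set ZFSet.{u}, ZFModel.IsTransitiveModel M →
        (∀ x ∈ ZFSet.funs (ZFModel.vN κ) (ZFModel.vN lam), x ∈ M) →
        (∃ g ∈ ZFSet.funs (ZFSet.funs (ZFModel.vN κ) (ZFModel.vN lam)) (ZFModel.vN κ),
          g ∈ M ∧
            ZFModel.Dominates (ZFSet.funs (ZFModel.vN κ) (ZFModel.vN lam)) g f) →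
        A ∈ M := by
  have hsucc := Cardinal.isSuccLimit_ord hκ
  have h0 {μ : Cardinal.{u}} (hμ : Cardinal.aleph0 ≤ μ) : ∅ ∈ ZFModel.vN μ := by
    rw [ZFModel.vN, ← Ordinal.toZFSet_zero, Ordinal.toZFSet_mem_toZFSet_iff]
    exact (Cardinal.isSuccLimit_ord hμ).bot_lt
  have hs : ∀ α ∈ ZFModel.vN κ, insert α α ∈ ZFModel.vN κ := by
    intro α hα
    obtain ⟨o, ho, rfl⟩ := Ordinal.mem_toZFSet_iff.1 hα
    rw [← Ordinal.toZFSet_add_one, ZFModel.vN, Ordinal.toZFSet_mem_toZFSet_iff]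
    exact hsucc.succ_lt ho
  have hK := ZFSet.isOrdinal_toZFSet κ.ord
  obtain ⟨f, hf, hfx⟩ := ZFModel.exists_firstEntrance (L := ZFModel.vN lam) (A := A) hK (h0 hκ) hs
  refine ⟨f, hf, hfx, fun M hM hx ⟨g, hg, hgM, hfg⟩ => ?_⟩
  exact ZFModel.mem_of_dominates hK.isTransitive (h0 hlam) hA (fun x hx => (hfx x hx).2)
    hM hx hg hgM hfg
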